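/- Let $A\in\mathbb R^{n\times n}$, $B\in\mathbb R^{n\times m}$, $\Xi\in\mathbb R^{n\times k}$, let $Q=Q^\top\succeq 0$, $R=R^\top\succ 0$ and $Q_f=Q_f^\top\succeq 0$ be real matrices of sizes $n\times n$, $m\times m$ and $n\times n$, and let $\lambda>0$. For each horizon $T$ consider the Riccati recursion $P_T:=Q_f$, $$P_t = Q + A^\top\Big[I + P_{t+1}BR^{-1}B^\top - \tfrac1\lambda P_{t+1}\Xi\Xi^\top\Big]^{-1}P_{t+1}A,\qquad t=T-1,\dots,0,$$ and the algebraic Riccati equation (ARE) $$P = Q + A^\top\Big[I + PBR^{-1}B^\top - \tfrac1\lambda P\,\Xi\Xi^\top\Big]^{-1}PA .$$ Put $W:=BR^{-1}B^\top-\tfrac1\lambda\Xi\Xi^\top$. Assume that 1. for every $T$ and every $t\le T$, $\lambda$ is strictly larger than the maximum eigenvalue of $\Xi^\top P_t\Xi$; 2. $W\succeq 0$, and $(A,\sqrt W)$ is stabilizable, i.e. $A+\sqrt W K$ has all its eigenvalues in the open unit disc for some real matrix $K$; 3. $(A,\sqrt Q)$ is observable; 4. $A$ is nonsingular. Let $$F:=\begin{bmatrix}A&0\\-Q&I\end{bmatrix},\qquad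 G:=\begin{bmatrix}I&W\\0&A^\top\end{bmatrix},\qquad H':=G^{-1}F .$$ Then the matrices inverted in the recursion are nonsingular, the ARE has exactly one symmetric positive semidefinite solution $P_{ss}$, and for every fixed $t$ the matrices $P_t=P_t^{(T)}$ of the recursion converge to $P_{ss}$ as $T\to\infty$. Moreover, there are $U_1,U_2\in\mathbb C^{n\times n}$ such that the $n$ columns of $\begin{bmatrix}U_1\\U_2\end{bmatrix}$ are linearly independent and each of them is an eigenvector of $H'$, or a generalized one (a nonzero vector annihilated by some power of $H'-\gamma I$), for a stable eigenvalue $\gamma$, i.e. $|\gamma|<1$; and for every such choice of $U_1,U_2$, in particular whenever the columns are $n$ linearly independent ordinary eigenvectors, $U_1$ is nonsingular and $P_{ss}=U_2U_1^{-1}$. -/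

import Mathlib

noncomputable section

open Matrix Filter Topology

namespace MinimaxLQ

variable {n m k : ℕ}

/-- The symmetric positive semidefinite square root `√M` of a positive semidefinite real matrix
`M`, namely Mathlib's `CFC.sqrt` for the Loewner order on matrices. -/
def psdSqrt (M : Matrix (Fin n) (Fin n) ℝ) : Matrix (Fin n) (Fin n) ℝ :=
  letI : PartialOrder (Matrix (Fin n) (Fin n) ℝ) := Matrix.instPartialOrder
  haveI : StarOrderedRing (Matrix (Fin n) (Fin n) ℝ) := Matrix.instStarOrderedRing
  haveI : NonnegSpectrumClass ℝ (Matrix (Fin n) (Fin n) ℝ) := Matrix.instNonnegSpectrumClass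
  CFC.sqrt M

/-- A real square matrix is (discrete-time) stable if all its complex eigenvalues lie in the open
unit disc. -/
def IsStable (M : Matrix (Fin n) (Fin n) ℝ) : Prop :=
  ∀ z : ℂ, Module.End.HasEigenvalue (Matrix.toLin' (M.map Complex.ofReal)) z → ‖z‖ < 1

/-- `(A, C)` is stabilizable: some linear state feedback `u = K x` makes `A + C K` stable. -/
def IsStabilizable (A : Matrix (Fin n) (Fin n) ℝ) (C : Matrix (Fin n) (Fin m) ℝ) : Prop :=
  ∃ K : Matrix (Fin m) (Fin n) ℝ, IsStable (A + C * K)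

/-- `(A, C)` is observable: the observability matrix, with block rows `C, C A, …, C A ^ (n - 1)`,
has trivial kernel (equivalently, full column rank `n`). -/
def IsObservable (A : Matrix (Fin n) (Fin n) ℝ) (C : Matrix (Fin m) (Fin n) ℝ) : Prop :=
  ∀ x : Fin n → ℝ, (∀ i < n, (C * A ^ i) *ᵥ x = 0) → x = 0

/-- `W = B R⁻¹ Bᵀ - (1 / lam) Ξ Ξᵀ`. -/
def wMatrix (B : Matrix (Fin n) (Fin m) ℝ) (Ξ : Matrix (Fin n) (Fin k) ℝ)
    (R : Matrix (Fin m) (Fin m) ℝ) (lam : ℝ) : Matrix (Fin n) (Fin n) ℝ :=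
  B * R⁻¹ * Bᵀ - (1 / lam) • (Ξ * Ξᵀ)

/-- The matrix `I + P B R⁻¹ Bᵀ - (1 / lam) P Ξ Ξᵀ` that is inverted in the Riccati equation. -/
def riccatiDen (B : Matrix (Fin n) (Fin m) ℝ) (Ξ : Matrix (Fin n) (Fin k) ℝ)
    (R : Matrix (Fin m) (Fin m) ℝ) (lam : ℝ) (P : Matrix (Fin n) (Fin n) ℝ) :
    Matrix (Fin n) (Fin n) ℝ :=
  1 + P * B * R⁻¹ * Bᵀ - (1 / lam) • (P * Ξ * Ξᵀ)

/-- One backward step `P ↦ Q + Aᵀ [I + P B R⁻¹ Bᵀ - (1 / lam) P Ξ Ξᵀ]⁻¹ P A` of the Riccati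
recursion. -/
def riccatiMap (A : Matrix (Fin n) (Fin n) ℝ) (B : Matrix (Fin n) (Fin m) ℝ)
    (Ξ : Matrix (Fin n) (Fin k) ℝ) (Q : Matrix (Fin n) (Fin n) ℝ) (R : Matrix (Fin m) (Fin m) ℝ)
    (lam : ℝ) (P : Matrix (Fin n) (Fin n) ℝ) : Matrix (Fin n) (Fin n) ℝ :=
  Q + Aᵀ * (riccatiDen B Ξ R lam P)⁻¹ * P * A

/-- The matrix `P_t` (for `t ≤ T`) of the backward Riccati recursion with horizon `T`:
`P_T = Qf` and `P_t = riccatiMap P_{t+1}` for `t < T`. -/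
def riccatiP (A : Matrix (Fin n) (Fin n) ℝ) (B : Matrix (Fin n) (Fin m) ℝ)
    (Ξ : Matrix (Fin n) (Fin k) ℝ) (Q : Matrix (Fin n) (Fin n) ℝ) (R : Matrix (Fin m) (Fin m) ℝ)
    (lam : ℝ) (Qf : Matrix (Fin n) (Fin n) ℝ) (T t : ℕ) : Matrix (Fin n) (Fin n) ℝ :=
  (riccatiMap A B Ξ Q R lam)^[T - t] Qf

/-- `P_T = Qf`. -/
theorem riccatiP_terminal (A : Matrix (Fin n) (Fin n) ℝ) (B : Matrix (Fin n) (Fin m) ℝ)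
    (Ξ : Matrix (Fin n) (Fin k) ℝ) (Q : Matrix (Fin n) (Fin n) ℝ) (R : Matrix (Fin m) (Fin m) ℝ)
    (lam : ℝ) (Qf : Matrix (Fin n) (Fin n) ℝ) (T : ℕ) :
    riccatiP A B Ξ Q R lam Qf T T = Qf := by
  simp [riccatiP]

/-- The recursion `P_t = riccatiMap P_{t+1}` for `t < T`. -/
theorem riccatiP_step (A : Matrix (Fin n) (Fin n) ℝ) (B : Matrix (Fin n) (Fin m) ℝ)
    (Ξ : Matrix (Fin n) (Fin k) ℝ) (Q : Matrix (Fin n) (Fin n) ℝ) (R : Matrix (Fin m) (Fin m) ℝ)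
    (lam : ℝ) (Qf : Matrix (Fin n) (Fin n) ℝ) (T t : ℕ) (h : t < T) :
    riccatiP A B Ξ Q R lam Qf T t
      = riccatiMap A B Ξ Q R lam (riccatiP A B Ξ Q R lam Qf T (t + 1)) := by
  have e : T - t = (T - (t + 1)) + 1 := by omega
  simp only [riccatiP, e, Function.iterate_succ_apply']

/-- `P` solves the algebraic Riccati equation
`P = Q + Aᵀ [I + P B R⁻¹ Bᵀ - (1 / lam) P Ξ Ξᵀ]⁻¹ P A`, the inverse being a genuine one. -/
def IsARESolution (A : Matrix (Fin n) (Fin n) ℝ) (B : Matrix (Fin n) (Fin m) ℝ)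
    (Ξ : Matrix (Fin n) (Fin k) ℝ) (Q : Matrix (Fin n) (Fin n) ℝ) (R : Matrix (Fin m) (Fin m) ℝ)
    (lam : ℝ) (P : Matrix (Fin n) (Fin n) ℝ) : Prop :=
  IsUnit (riccatiDen B Ξ R lam P) ∧ P = riccatiMap A B Ξ Q R lam P

/-- The penalty condition: along the recursion from `Qf`, for every horizon `T` and every stage
`t ≤ T`, each (real) eigenvalue of the symmetric matrix `Ξᵀ P_t Ξ`, equivalently the largest one,
is strictly below `lam`. -/
def PenaltyCondition (A : Matrix (Fin n) (Fin n) ℝ) (B : Matrix (Fin n) (Fin m) ℝ)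
    (Ξ : Matrix (Fin n) (Fin k) ℝ) (Q : Matrix (Fin n) (Fin n) ℝ) (R : Matrix (Fin m) (Fin m) ℝ)
    (lam : ℝ) (Qf : Matrix (Fin n) (Fin n) ℝ) : Prop :=
  ∀ T t : ℕ, t ≤ T → ∀ μ : ℝ,
    Module.End.HasEigenvalue (Matrix.toLin' (Ξᵀ * riccatiP A B Ξ Q R lam Qf T t * Ξ)) μ → μ < lam

/-- `F = [[A, 0], [-Q, I]]`. -/
def fMatrix (A Q : Matrix (Fin n) (Fin n) ℝ) : Matrix (Fin n ⊕ Fin n) (Fin n ⊕ Fin n) ℝ :=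
  Matrix.fromBlocks A 0 (-Q) 1

/-- `G = [[I, W], [0, Aᵀ]]`. -/
def gMatrix (A W : Matrix (Fin n) (Fin n) ℝ) : Matrix (Fin n ⊕ Fin n) (Fin n ⊕ Fin n) ℝ :=
  Matrix.fromBlocks 1 W 0 Aᵀ

/-- `H' = G⁻¹ F` (for nonsingular `A`, so that `G` is nonsingular). -/
def hMatrix (A W Q : Matrix (Fin n) (Fin n) ℝ) : Matrix (Fin n ⊕ Fin n) (Fin n ⊕ Fin n) ℝ :=
  (gMatrix A W)⁻¹ * fMatrix A Q

/-- The columns of the complex `2n × n` matrix `[U₁; U₂]` are linearly independent, and each of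
them is a (possibly generalized) eigenvector of the real matrix `H` for a stable eigenvalue, i.e.
it is annihilated by a power of `H - γ I` for some `γ` with `|γ| < 1`. Every matrix of `n`
linearly independent ordinary eigenvectors qualifies, and so does every matrix of Jordan chains. -/
def IsStableEigenbasis (H : Matrix (Fin n ⊕ Fin n) (Fin n ⊕ Fin n) ℝ)
    (U₁ U₂ : Matrix (Fin n) (Fin n) ℂ) : Prop :=
  LinearIndependent ℂ (Matrix.fromRows U₁ U₂).col ∧
    ∀ j : Fin n, ∃ γ : ℂ, ‖γ‖ < 1 ∧
      (Matrix.fromRows U₁ U₂).col j ∈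
        Module.End.maxGenEigenspace (Matrix.toLin' (H.map Complex.ofReal)) γ

end MinimaxLQ

end

/-! Since `W` is positive semidefinite, it equals `C Cᵀ` with `C = √W`, and the minimax recursion is
an ordinary LQ recursion for `x ↦ A x + C u` with cost `xᵀ Q x + uᵀ u`. Completion of squares makes
`riccatiStep` the Loewner minimum over gains `K` of the maps `costStep`, which are affine and
monotone. Hence the iterates from `0` increase, stay below the cost of a stabilizing gain, and
converge to a fixed point `P`.

By observability, every positive semidefinite fixed point has a stable closed loop
(`isStable_closedLoop`). This gives uniqueness, because the difference of two fixed points is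
contracted to `0` by their closed loops. It also gives convergence from any start: the iterates lie
between those from `0` and the costs under the optimal gain of `P`, which both tend to `P`.

For the spectral formula, the graph of `P` is `H'`-invariant with `H'` acting as the closed loop, so
it contains `n` independent stable generalized eigenvectors. Modulo the graph, `H'` acts as the
inverse transpose of the closed loop, so no stable generalized eigenvector lies outside it. -/

section RiccatiTheory

open Matrix Filter Topology
open scoped MatrixOrder ComplexOrder

namespace MinimaxLQ

variable {n m k : ℕ}

/-! ### Square roots and positive semidefinite matrices -/

section SquareRoot

theorem psdSqrt_mul_self {M : Matrix (Fin n) (Fin n) ℝ} (hM : M.PosSemidef) :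
    psdSqrt M * psdSqrt M = M :=
  CFC.sqrt_mul_sqrt_self M hM.nonneg

theorem posSemidef_psdSqrt (M : Matrix (Fin n) (Fin n) ℝ) : (psdSqrt M).PosSemidef :=
  (CFC.sqrt_nonneg M).posSemidef

theorem transpose_psdSqrt (M : Matrix (Fin n) (Fin n) ℝ) : (psdSqrt M)ᵀ = psdSqrt M := by
  simpa using (posSemidef_psdSqrt M).isHermitian.eq

theorem transpose_eq_of_posSemidef {M : Matrix (Fin n) (Fin n) ℝ} (hM : M.PosSemidef) :
    Mᵀ = M := by
  simpa using hM.isHermitian.eq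

theorem posSemidef_transpose_mul_mul {P : Matrix (Fin n) (Fin n) ℝ} (hP : P.PosSemidef)
    (M : Matrix (Fin n) (Fin m) ℝ) : (Mᵀ * P * M).PosSemidef := by
  simpa using hP.conjTranspose_mul_mul_same M

theorem posSemidef_transpose_mul_self (M : Matrix (Fin n) (Fin m) ℝ) :
    (Mᵀ * M).PosSemidef := by
  simpa using posSemidef_conjTranspose_mul_self M

/-- Sylvester's identity `det (1 + X Y) = det (1 + Y X)` moves one factor `√W` to the other side and
leaves a positive definite matrix. -/
theorem isUnit_one_add_mul {P W : Matrix (Fin n) (Fin n) ℝ} (hP : P.PosSemidef)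
    (hW : W.PosSemidef) : IsUnit (1 + P * W) := by
  have h : (1 + (psdSqrt W)ᵀ * P * psdSqrt W).PosDef :=
    PosDef.one.add_posSemidef (posSemidef_transpose_mul_mul hP _)
  rw [isUnit_iff_isUnit_det]
  have e : (1 + P * W).det = (1 + (psdSqrt W)ᵀ * P * psdSqrt W).det := by
    conv_lhs => rw [← psdSqrt_mul_self hW, ← mul_assoc, det_one_add_mul_comm]
    rw [transpose_psdSqrt, mul_assoc]
  rw [e]
  exact h.det_pos.ne'.isUnit

end SquareRoot

/-! ### Riccati map, closed loop and fixed-gain costs -/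

section Algebra

/-- The closed loop matrix `(I + W P)⁻¹ A`. -/
noncomputable def closedLoop (A W P : Matrix (Fin n) (Fin n) ℝ) : Matrix (Fin n) (Fin n) ℝ :=
  (1 + W * P)⁻¹ * A

/-- The Riccati map `P ↦ Q + Aᵀ P (I + W P)⁻¹ A`. -/
noncomputable def riccatiStep (A W Q P : Matrix (Fin n) (Fin n) ℝ) : Matrix (Fin n) (Fin n) ℝ :=
  Q + Aᵀ * P * closedLoop A W P

/-- The one-step cost map of the fixed feedback `u = K x`. -/
def costStep (A : Matrix (Fin n) (Fin n) ℝ) (C : Matrix (Fin n) (Fin m) ℝ)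
    (Q : Matrix (Fin n) (Fin n) ℝ) (K : Matrix (Fin m) (Fin n) ℝ)
    (P : Matrix (Fin n) (Fin n) ℝ) : Matrix (Fin n) (Fin n) ℝ :=
  Q + Kᵀ * K + (A + C * K)ᵀ * P * (A + C * K)

/-- The gain minimizing `costStep A C Q K P`. -/
noncomputable def optGain (A : Matrix (Fin n) (Fin n) ℝ) (C : Matrix (Fin n) (Fin m) ℝ)
    (P : Matrix (Fin n) (Fin n) ℝ) : Matrix (Fin m) (Fin n) ℝ :=
  -(Cᵀ * P * closedLoop A (C * Cᵀ) P)

theorem riccatiDen_eq (B : Matrix (Fin n) (Fin m) ℝ) (Ξ : Matrix (Fin n) (Fin k) ℝ)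
    (R : Matrix (Fin m) (Fin m) ℝ) (lam : ℝ) (P : Matrix (Fin n) (Fin n) ℝ) :
    riccatiDen B Ξ R lam P = 1 + P * wMatrix B Ξ R lam := by
  simp only [riccatiDen, wMatrix, mul_sub, Matrix.mul_smul, Matrix.mul_assoc]
  abel

theorem one_add_mul_closedLoop {A W P : Matrix (Fin n) (Fin n) ℝ} (hW : W.PosSemidef)
    (hP : P.PosSemidef) : closedLoop A W P + W * P * closedLoop A W P = A := by
  have h := (isUnit_iff_isUnit_det _).1 (isUnit_one_add_mul hW hP)
  rw [← one_add_mul, closedLoop, mul_nonsing_inv_cancel_left _ _ h]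

theorem transpose_closedLoop_mul {A W P : Matrix (Fin n) (Fin n) ℝ} (hW : W.PosSemidef)
    (hP : P.PosSemidef) :
    (closedLoop A W P)ᵀ + (closedLoop A W P)ᵀ * P * W = Aᵀ := by
  conv_rhs => rw [← one_add_mul_closedLoop (A := A) hW hP]
  simp only [transpose_add, transpose_mul, transpose_eq_of_posSemidef hW,
    transpose_eq_of_posSemidef hP, mul_assoc]

/-- The push-through identity `(1 + P W)⁻¹ P = P (1 + W P)⁻¹`. -/
theorem riccatiMap_eq_riccatiStep {A Q : Matrix (Fin n) (Fin n) ℝ}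
    {B : Matrix (Fin n) (Fin m) ℝ} {Ξ : Matrix (Fin n) (Fin k) ℝ}
    {R : Matrix (Fin m) (Fin m) ℝ} {lam : ℝ} {P : Matrix (Fin n) (Fin n) ℝ}
    (hW : (wMatrix B Ξ R lam).PosSemidef) (hP : P.PosSemidef) :
    riccatiMap A B Ξ Q R lam P = riccatiStep A (wMatrix B Ξ R lam) Q P := by
  rw [riccatiMap, riccatiStep, riccatiDen_eq]
  set W := wMatrix B Ξ R lam
  have h := (isUnit_iff_isUnit_det _).1 (isUnit_one_add_mul hP hW)
  have e : P * A = (1 + P * W) * (P * closedLoop A W P) := by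
    conv_lhs => rw [← one_add_mul_closedLoop (A := A) hW hP]
    noncomm_ring
  rw [mul_assoc (Aᵀ * _), e, mul_assoc, nonsing_inv_mul_cancel_left _ _ h, mul_assoc]

/-- Substituting `Aᵀ = Mᵀ + Mᵀ P W`, with `M` the closed loop, gives a form that is visibly positive
semidefinite. At a fixed point it is a Lyapunov equation for `M`. -/
theorem riccatiStep_eq_closedLoop {A W Q P : Matrix (Fin n) (Fin n) ℝ} (hW : W.PosSemidef)
    (hP : P.PosSemidef) :
    riccatiStep A W Q P = Q + ((closedLoop A W P)ᵀ * P * closedLoop A W P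
      + (P * closedLoop A W P)ᵀ * W * (P * closedLoop A W P)) := by
  rw [riccatiStep, ← transpose_closedLoop_mul (A := A) hW hP]
  simp only [transpose_mul, transpose_eq_of_posSemidef hP]
  noncomm_ring

theorem posSemidef_riccatiStep {A W Q P : Matrix (Fin n) (Fin n) ℝ} (hW : W.PosSemidef)
    (hQ : Q.PosSemidef) (hP : P.PosSemidef) : (riccatiStep A W Q P).PosSemidef := by
  rw [riccatiStep_eq_closedLoop hW hP]
  exact hQ.add ((posSemidef_transpose_mul_mul hP _).add (posSemidef_transpose_mul_mul hW _))

theorem posSemidef_iterate_riccatiStep {A W Q P : Matrix (Fin n) (Fin n) ℝ} (hW : W.PosSemidef)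
    (hQ : Q.PosSemidef) (hP : P.PosSemidef) (N : ℕ) :
    ((riccatiStep A W Q)^[N] P).PosSemidef := by
  induction N with
  | zero => exact hP
  | succ N ih =>
    rw [Function.iterate_succ_apply']
    exact posSemidef_riccatiStep hW hQ ih

theorem riccatiStep_eq_transpose_closedLoop_mul {A W Q P : Matrix (Fin n) (Fin n) ℝ}
    (hW : W.PosSemidef) (hP : P.PosSemidef) :
    riccatiStep A W Q P = Q + (closedLoop A W P)ᵀ * P * A := by
  have h := one_add_mul_closedLoop (A := A) hW hP
  rw [riccatiStep, ← transpose_closedLoop_mul (A := A) hW hP]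
  generalize closedLoop A W P = M at *
  rw [← h]
  noncomm_ring

/-- The difference of two values of the Riccati map factors through both closed loops. -/
theorem riccatiStep_sub_riccatiStep {A W Q P P' : Matrix (Fin n) (Fin n) ℝ} (hW : W.PosSemidef)
    (hP : P.PosSemidef) (hP' : P'.PosSemidef) :
    riccatiStep A W Q P - riccatiStep A W Q P'
      = (closedLoop A W P)ᵀ * (P - P') * closedLoop A W P' := by
  have h2 : A = closedLoop A W P' + W * P' * closedLoop A W P' :=
    (one_add_mul_closedLoop hW hP').symm
  have h3 : Aᵀ = (closedLoop A W P)ᵀ + (closedLoop A W P)ᵀ * P * W :=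
    (transpose_closedLoop_mul hW hP).symm
  rw [riccatiStep_eq_transpose_closedLoop_mul hW hP, riccatiStep, h3]
  generalize closedLoop A W P = M at *
  generalize closedLoop A W P' = M' at *
  rw [h2]
  noncomm_ring

variable {A Q P P' : Matrix (Fin n) (Fin n) ℝ} {C : Matrix (Fin n) (Fin m) ℝ}

theorem posSemidef_mul_transpose_self (C : Matrix (Fin n) (Fin m) ℝ) :
    (C * Cᵀ).PosSemidef := by
  simpa using posSemidef_self_mul_conjTranspose C

theorem add_mul_optGain (hP : P.PosSemidef) :
    A + C * optGain A C P = closedLoop A (C * Cᵀ) P := by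
  have h := one_add_mul_closedLoop (A := A) (posSemidef_mul_transpose_self C) hP
  rw [optGain]
  nth_rewrite 1 [← h]
  simp only [Matrix.mul_neg, Matrix.mul_assoc]
  abel

/-- Completion of squares. -/
theorem costStep_eq_riccatiStep_add (hP : P.PosSemidef) (K : Matrix (Fin m) (Fin n) ℝ) :
    costStep A C Q K P = riccatiStep A (C * Cᵀ) Q P
      + ((K - optGain A C P)ᵀ * (K - optGain A C P)
        + (C * (K - optGain A C P))ᵀ * P * (C * (K - optGain A C P))) := by
  obtain ⟨V, rfl⟩ : ∃ V, K = optGain A C P + V := ⟨K - optGain A C P, by abel⟩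
  have e : A + C * (optGain A C P + V) = closedLoop A (C * Cᵀ) P + C * V := by
    rw [Matrix.mul_add, ← add_assoc, add_mul_optGain hP]
  rw [costStep, e, riccatiStep_eq_closedLoop (posSemidef_mul_transpose_self C) hP,
    add_sub_cancel_left, optGain]
  generalize closedLoop A (C * Cᵀ) P = M
  simp only [transpose_add, transpose_mul, transpose_neg, transpose_transpose,
    transpose_eq_of_posSemidef hP, Matrix.mul_add, Matrix.add_mul, Matrix.mul_neg, Matrix.neg_mul,
    Matrix.mul_assoc]
  abel

theorem costStep_optGain (hP : P.PosSemidef) :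
    costStep A C Q (optGain A C P) P = riccatiStep A (C * Cᵀ) Q P := by
  simp [costStep_eq_riccatiStep_add hP]

theorem riccatiStep_le_costStep (hP : P.PosSemidef) (K : Matrix (Fin m) (Fin n) ℝ) :
    riccatiStep A (C * Cᵀ) Q P ≤ costStep A C Q K P := by
  rw [Matrix.le_iff, costStep_eq_riccatiStep_add hP, add_sub_cancel_left]
  exact (posSemidef_transpose_mul_self _).add (posSemidef_transpose_mul_mul hP _)

theorem costStep_mono (K : Matrix (Fin m) (Fin n) ℝ) : Monotone (costStep A C Q K) := by
  intro P P' h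
  rw [Matrix.le_iff] at h ⊢
  have e : costStep A C Q K P' - costStep A C Q K P
      = (A + C * K)ᵀ * (P' - P) * (A + C * K) := by
    simp only [costStep, Matrix.mul_sub, Matrix.sub_mul]
    abel
  rw [e]
  exact posSemidef_transpose_mul_mul h _

/-- The gain optimal for `P'` is admissible for `P`, and its cost is monotone in the matrix. -/
theorem riccatiStep_mono (hP : P.PosSemidef) (hP' : P'.PosSemidef) (h : P ≤ P') :
    riccatiStep A (C * Cᵀ) Q P ≤ riccatiStep A (C * Cᵀ) Q P' := by
  rw [← costStep_optGain hP']
  exact (riccatiStep_le_costStep hP _).trans (costStep_mono _ h)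

theorem iterate_riccatiStep_mono (hQ : Q.PosSemidef) (hP : P.PosSemidef) (hP' : P'.PosSemidef)
    (h : P ≤ P') (N : ℕ) :
    (riccatiStep A (C * Cᵀ) Q)^[N] P ≤ (riccatiStep A (C * Cᵀ) Q)^[N] P' := by
  have hW := posSemidef_mul_transpose_self C
  induction N with
  | zero => exact h
  | succ N ih =>
    simp only [Function.iterate_succ_apply']
    exact riccatiStep_mono (posSemidef_iterate_riccatiStep hW hQ hP N)
      (posSemidef_iterate_riccatiStep hW hQ hP' N) ih

theorem iterate_riccatiStep_le_iterate_costStep (hQ : Q.PosSemidef) (hP : P.PosSemidef)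
    (K : Matrix (Fin m) (Fin n) ℝ) (N : ℕ) :
    (riccatiStep A (C * Cᵀ) Q)^[N] P ≤ (costStep A C Q K)^[N] P := by
  induction N with
  | zero => exact le_rfl
  | succ N ih =>
    simp only [Function.iterate_succ_apply']
    exact (riccatiStep_le_costStep
      (posSemidef_iterate_riccatiStep (posSemidef_mul_transpose_self C) hQ hP N) K).trans
      (costStep_mono K ih)

theorem monotone_iterate_riccatiStep_zero (hQ : Q.PosSemidef) :
    Monotone fun N : ℕ => (riccatiStep A (C * Cᵀ) Q)^[N] 0 := by
  refine monotone_nat_of_le_succ fun N => ?_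
  rw [Function.iterate_succ_apply]
  have h := posSemidef_riccatiStep (A := A) (posSemidef_mul_transpose_self C) hQ PosSemidef.zero
  exact iterate_riccatiStep_mono hQ PosSemidef.zero h h.nonneg N

/-- `costStep` is affine with linear part `D ↦ Mᵀ D M`, `M = A + C K`, so deviations from its fixed
point are conjugated by powers of `M`. -/
theorem iterate_costStep_eq (K : Matrix (Fin m) (Fin n) ℝ) (hP : costStep A C Q K P = P) (N : ℕ)
    (X : Matrix (Fin n) (Fin n) ℝ) :
    (costStep A C Q K)^[N] X = P + ((A + C * K) ^ N)ᵀ * (X - P) * (A + C * K) ^ N := by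
  induction N with
  | zero => simp
  | succ N ih =>
    have e (D) : costStep A C Q K (P + D) = costStep A C Q K P
        + (A + C * K)ᵀ * D * (A + C * K) := by
      simp only [costStep, Matrix.mul_add, Matrix.add_mul]
      abel
    rw [Function.iterate_succ_apply', ih, e, hP, pow_succ, transpose_mul]
    simp only [Matrix.mul_assoc]

end Algebra

/-! ### Powers of stable matrices and the Lyapunov equation -/

section PowerConvergence

/-- Gelfand's formula: for some `r < 1`, eventually `‖a ^ N‖ < r ^ N`. -/
theorem tendsto_pow_of_spectralRadius_lt_one {E : Type*} [NormedRing E] [NormedAlgebra ℂ E]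
    [CompleteSpace E] {a : E} (ha : spectralRadius ℂ a < 1) :
    Tendsto (fun N : ℕ => a ^ N) atTop (𝓝 0) := by
  obtain ⟨r, hr, hr1⟩ := ENNReal.lt_iff_exists_nnreal_btwn.1 ha
  have h := (spectrum.pow_nnnorm_pow_one_div_tendsto_nhds_spectralRadius a).eventually_lt_const hr
  have hr1' : r < 1 := by exact_mod_cast hr1
  rw [tendsto_zero_iff_norm_tendsto_zero]
  refine squeeze_zero' (Eventually.of_forall fun _ => norm_nonneg _) ?_
    (tendsto_pow_atTop_nhds_zero_of_lt_one r.2 (by exact_mod_cast hr1'))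
  filter_upwards [h, eventually_gt_atTop 0] with N hN hN0
  rw [one_div, ENNReal.rpow_inv_lt_iff (by positivity), ENNReal.rpow_natCast] at hN
  exact_mod_cast hN.le

section
attribute [local instance] Matrix.linftyOpNormedRing Matrix.linftyOpNormedAlgebra

theorem tendsto_pow_of_hasEigenvalue_norm_lt_one (M : Matrix (Fin n) (Fin n) ℂ)
    (hM : ∀ z : ℂ, Module.End.HasEigenvalue (Matrix.toLin' M) z → ‖z‖ < 1) :
    Tendsto (fun N : ℕ => M ^ N) atTop (𝓝 0) := by
  rcases isEmpty_or_nonempty (Fin n) with h | h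
  -- For `n = 0` the matrix ring is trivial and the spectrum is empty, so this case is separate.
  · exact tendsto_const_nhds.congr fun _ => Subsingleton.elim _ _
  · refine tendsto_pow_of_spectralRadius_lt_one ?_
    refine spectrum.spectralRadius_lt_of_forall_lt M (r := 1) fun z hz => ?_
    rw [← Matrix.spectrum_toLin', ← Module.End.hasEigenvalue_iff_mem_spectrum] at hz
    exact_mod_cast hM z hz

end

theorem IsStable.tendsto_pow {M : Matrix (Fin n) (Fin n) ℝ} (hM : IsStable M) :
    Tendsto (fun N : ℕ => M ^ N) atTop (𝓝 0) := by
  have h := tendsto_pow_of_hasEigenvalue_norm_lt_one _ hM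
  refine tendsto_pi_nhds.2 fun i => tendsto_pi_nhds.2 fun j => ?_
  have hij := (Complex.continuous_re.tendsto _).comp
    (tendsto_pi_nhds.1 (tendsto_pi_nhds.1 h i) j)
  refine hij.congr fun N => ?_
  have e : (M.map Complex.ofReal) ^ N = (M ^ N).map Complex.ofReal :=
    (map_pow (Complex.ofRealHom.mapMatrix) M N).symm
  simp [e]

theorem tendsto_transpose_mul_mul {M M' : ℕ → Matrix (Fin n) (Fin n) ℝ}
    (hM : Tendsto M atTop (𝓝 0)) (hM' : Tendsto M' atTop (𝓝 0)) (X : Matrix (Fin n) (Fin n) ℝ) :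
    Tendsto (fun N => (M N)ᵀ * X * M' N) atTop (𝓝 0) := by
  have h : Tendsto (fun N => (M N)ᵀ) atTop (𝓝 (0 : Matrix (Fin n) (Fin n) ℝ)ᵀ) :=
    (continuous_id.matrix_transpose.tendsto 0).comp hM
  simpa using (h.mul_const X).mul hM'

/-- A fixed point of the map `X ↦ S + Mᵀ X M` exists for stable `M`. -/
theorem exists_lyapunov_solution {M : Matrix (Fin n) (Fin n) ℝ}
    (hM : Tendsto (fun N : ℕ => M ^ N) atTop (𝓝 0)) (S : Matrix (Fin n) (Fin n) ℝ) :
    ∃ X, S + Mᵀ * X * M = X := by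
  let f : Matrix (Fin n) (Fin n) ℝ →ₗ[ℝ] Matrix (Fin n) (Fin n) ℝ :=
    LinearMap.id - (LinearMap.mulLeft ℝ Mᵀ) ∘ₗ (LinearMap.mulRight ℝ M)
  have hf (X) : f X = X - Mᵀ * X * M := by simp [f, Matrix.mul_assoc]
  -- A kernel element satisfies `X = (M ^ N)ᵀ X M ^ N → 0`; in finite dimension injectivity gives
  -- surjectivity.
  have hinj : Function.Injective f := by
    refine (injective_iff_map_eq_zero f).2 fun X hX => ?_
    rw [hf, sub_eq_zero] at hX
    have h (N : ℕ) : (M ^ N)ᵀ * X * M ^ N = X := by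
      induction N with
      | zero => simp
      | succ N ih =>
        rw [pow_succ, transpose_mul]
        calc _ = Mᵀ * ((M ^ N)ᵀ * X * M ^ N) * M := by simp only [Matrix.mul_assoc]
          _ = X := by rw [ih, ← hX]
    exact tendsto_nhds_unique (tendsto_const_nhds.congr fun N => (h N).symm)
      (tendsto_transpose_mul_mul hM hM X)
  obtain ⟨X, hX⟩ := LinearMap.injective_iff_surjective.1 hinj S
  exact ⟨X, by rw [← hX, hf]; abel⟩

theorem tendsto_iterate_costStep {A Q P X : Matrix (Fin n) (Fin n) ℝ}
    {C : Matrix (Fin n) (Fin m) ℝ} {K : Matrix (Fin m) (Fin n) ℝ}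
    (hK : IsStable (A + C * K)) (hP : costStep A C Q K P = P) :
    Tendsto (fun N : ℕ => (costStep A C Q K)^[N] X) atTop (𝓝 P) := by
  simp only [iterate_costStep_eq K hP]
  simpa using (tendsto_transpose_mul_mul hK.tendsto_pow hK.tendsto_pow (X - P)).const_add P

end PowerConvergence

/-! ### Limits in the Loewner order -/

section MonotoneConvergence

theorem continuous_quadForm (x : Fin n → ℝ) :
    Continuous fun M : Matrix (Fin n) (Fin n) ℝ => x ⬝ᵥ M *ᵥ x := by
  fun_prop

theorem quadForm_le {M M' : Matrix (Fin n) (Fin n) ℝ} (h : M ≤ M') (x : Fin n → ℝ) :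
    x ⬝ᵥ M *ᵥ x ≤ x ⬝ᵥ M' *ᵥ x := by
  have := (Matrix.le_iff.1 h).dotProduct_mulVec_nonneg x
  simpa [sub_mulVec] using this

theorem polarization {M : Matrix (Fin n) (Fin n) ℝ} (hM : Mᵀ = M) (i j : Fin n) :
    M i j = ((Pi.single i 1 + Pi.single j 1) ⬝ᵥ M *ᵥ (Pi.single i 1 + Pi.single j 1)
      - Pi.single i 1 ⬝ᵥ M *ᵥ Pi.single i 1 - Pi.single j 1 ⬝ᵥ M *ᵥ Pi.single j 1) / 2 := by
  have h : M j i = M i j := congrFun (congrFun hM i) j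
  simp [mulVec_add, h]
  ring

theorem exists_tendsto_of_tendsto_quadForm {Y : ℕ → Matrix (Fin n) (Fin n) ℝ}
    (hY : ∀ N, (Y N)ᵀ = Y N)
    (h : ∀ x, ∃ l, Tendsto (fun N => x ⬝ᵥ Y N *ᵥ x) atTop (𝓝 l)) :
    ∃ L, Tendsto Y atTop (𝓝 L) := by
  choose q hq using h
  refine ⟨Matrix.of fun i j => (q (Pi.single i 1 + Pi.single j 1) - q (Pi.single i 1)
    - q (Pi.single j 1)) / 2, ?_⟩
  refine tendsto_pi_nhds.2 fun i => tendsto_pi_nhds.2 fun j => ?_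
  exact ((((hq _).sub (hq _)).sub (hq _)).div_const 2).congr fun N => (polarization (hY N) i j).symm

theorem eq_of_quadForm_eq {M M' : Matrix (Fin n) (Fin n) ℝ} (hM : Mᵀ = M) (hM' : M'ᵀ = M')
    (h : ∀ x, x ⬝ᵥ M *ᵥ x = x ⬝ᵥ M' *ᵥ x) : M = M' := by
  ext i j
  rw [polarization hM, polarization hM']
  simp only [h]

/-- The scalar squeeze theorem applies to each quadratic form, and polarization recovers the
entries. -/
theorem tendsto_of_le_of_le {X Y Z : ℕ → Matrix (Fin n) (Fin n) ℝ}
    {L : Matrix (Fin n) (Fin n) ℝ} (hY : ∀ N, (Y N)ᵀ = Y N) (hL : Lᵀ = L)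
    (hX : Tendsto X atTop (𝓝 L)) (hZ : Tendsto Z atTop (𝓝 L)) (h1 : ∀ N, X N ≤ Y N)
    (h2 : ∀ N, Y N ≤ Z N) : Tendsto Y atTop (𝓝 L) := by
  have hq (x : Fin n → ℝ) : Tendsto (fun N => x ⬝ᵥ Y N *ᵥ x) atTop (𝓝 (x ⬝ᵥ L *ᵥ x)) :=
    tendsto_of_tendsto_of_tendsto_of_le_of_le
      (((continuous_quadForm x).tendsto L).comp hX) (((continuous_quadForm x).tendsto L).comp hZ)
      (fun N => quadForm_le (h1 N) x) (fun N => quadForm_le (h2 N) x)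
  obtain ⟨L', hL'⟩ := exists_tendsto_of_tendsto_quadForm hY fun x => ⟨_, hq x⟩
  have hs : L'ᵀ = L' := tendsto_nhds_unique
    (((continuous_id.matrix_transpose.tendsto L').comp hL').congr fun N => hY N) hL'
  have e : L' = L := eq_of_quadForm_eq hs hL fun x =>
    tendsto_nhds_unique (((continuous_quadForm x).tendsto L').comp hL') (hq x)
  exact e ▸ hL'

/-- The upper bound may vary with `N`: its convergence already bounds every quadratic form. -/
theorem exists_tendsto_of_monotone {Y Z : ℕ → Matrix (Fin n) (Fin n) ℝ}
    {L : Matrix (Fin n) (Fin n) ℝ} (hY : ∀ N, (Y N)ᵀ = Y N) (hmono : Monotone Y)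
    (hZ : Tendsto Z atTop (𝓝 L)) (h : ∀ N, Y N ≤ Z N) : ∃ L', Tendsto Y atTop (𝓝 L') := by
  refine exists_tendsto_of_tendsto_quadForm hY fun x => ⟨_, tendsto_atTop_ciSup
    (fun N N' hN => quadForm_le (hmono hN) x) ?_⟩
  obtain ⟨b, hb⟩ := (((continuous_quadForm x).tendsto L).comp hZ).bddAbove_range
  refine ⟨b, ?_⟩
  rintro _ ⟨N, rfl⟩
  exact (quadForm_le (h N) x).trans (hb ⟨N, rfl⟩)

theorem posSemidef_of_tendsto {Y : ℕ → Matrix (Fin n) (Fin n) ℝ}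
    {L : Matrix (Fin n) (Fin n) ℝ} (hY : ∀ N, (Y N).PosSemidef) (h : Tendsto Y atTop (𝓝 L)) :
    L.PosSemidef := by
  refine PosSemidef.of_dotProduct_mulVec_nonneg ?_ fun x => ?_
  · have hs : Lᵀ = L := tendsto_nhds_unique
      (((continuous_id.matrix_transpose.tendsto L).comp h).congr
        fun N => transpose_eq_of_posSemidef (hY N)) h
    simpa [IsHermitian] using hs
  · exact ge_of_tendsto' (((continuous_quadForm x).tendsto L).comp h)
      fun N => (hY N).dotProduct_mulVec_nonneg x

end MonotoneConvergence

/-! ### A fixed point as the limit from zero -/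

section Existence

theorem riccatiStep_eq_of_tendsto {A W Q P : Matrix (Fin n) (Fin n) ℝ}
    {Y : ℕ → Matrix (Fin n) (Fin n) ℝ} (hA : IsUnit A) (hW : W.PosSemidef)
    (hY : ∀ N, (Y N).PosSemidef) (hstep : ∀ N, Y (N + 1) = riccatiStep A W Q (Y N))
    (h : Tendsto Y atTop (𝓝 P)) : riccatiStep A W Q P = P := by
  have hA' := (isUnit_iff_isUnit_det _).1 hA
  have hAt : IsUnit (Aᵀ).det := by rwa [det_transpose]
  have hP := posSemidef_of_tendsto hY h
  -- Inverting `Aᵀ` turns the step into a relation polynomial in `X` and its image, so the limit can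
  -- be taken without continuity of matrix inversion.
  have e {X : Matrix (Fin n) (Fin n) ℝ} (hX : X.PosSemidef) :
      (1 + X * W) * (Aᵀ⁻¹ * (riccatiStep A W Q X - Q)) = X * A := by
    have h1 : Aᵀ⁻¹ * (riccatiStep A W Q X - Q) = X * closedLoop A W X := by
      rw [riccatiStep, add_sub_cancel_left, mul_assoc, nonsing_inv_mul_cancel_left _ _ hAt]
    rw [h1]
    conv_rhs => rw [← one_add_mul_closedLoop (A := A) hW hX]
    noncomm_ring
  have h1 : Tendsto (fun N => (1 + Y N * W) * (Aᵀ⁻¹ * (Y (N + 1) - Q))) atTop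
      (𝓝 ((1 + P * W) * (Aᵀ⁻¹ * (P - Q)))) :=
    ((h.mul_const W).const_add 1).mul
      ((((tendsto_add_atTop_iff_nat 1).2 h).sub_const Q).const_mul _)
  have h2 : (1 + P * W) * (Aᵀ⁻¹ * (P - Q)) = P * A :=
    tendsto_nhds_unique h1 ((h.mul_const A).congr fun N => by rw [hstep, e (hY N)])
  rw [← e hP] at h2
  have h3 := (isUnit_one_add_mul hP hW).mul_left_cancel h2
  have hinv := (isUnit_iff_isUnit_det _).2 (isUnit_nonsing_inv_det_iff.2 hAt)
  have h4 := hinv.mul_left_cancel h3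
  exact (sub_left_injective h4).symm

theorem exists_tendsto_iterate_riccatiStep_zero {A Q : Matrix (Fin n) (Fin n) ℝ}
    {C : Matrix (Fin n) (Fin m) ℝ} (hA : IsUnit A) (hQ : Q.PosSemidef)
    (hstab : IsStabilizable A C) :
    ∃ P : Matrix (Fin n) (Fin n) ℝ, P.PosSemidef ∧ riccatiStep A (C * Cᵀ) Q P = P ∧
      Tendsto (fun N : ℕ => (riccatiStep A (C * Cᵀ) Q)^[N] 0) atTop (𝓝 P) := by
  obtain ⟨K, hK⟩ := hstab
  obtain ⟨L, hL⟩ := exists_lyapunov_solution hK.tendsto_pow (Q + Kᵀ * K)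
  have hW := posSemidef_mul_transpose_self C
  have hpsd := posSemidef_iterate_riccatiStep (A := A) hW hQ PosSemidef.zero
  obtain ⟨P, hP⟩ := exists_tendsto_of_monotone (fun N => transpose_eq_of_posSemidef (hpsd N))
    (monotone_iterate_riccatiStep_zero hQ) (tendsto_iterate_costStep hK hL)
    (iterate_riccatiStep_le_iterate_costStep hQ PosSemidef.zero K)
  exact ⟨P, posSemidef_of_tendsto hpsd hP, riccatiStep_eq_of_tendsto hA hW hpsd
    (fun N => Function.iterate_succ_apply' _ _ _) hP, hP⟩

end Existence

/-! ### Passage to complex vectors and observability -/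

section Complexification

theorem map_ofReal_mul {l p q : Type*} [Fintype p] (M : Matrix l p ℝ) (M' : Matrix p q ℝ) :
    (M * M').map Complex.ofReal = M.map Complex.ofReal * M'.map Complex.ofReal :=
  Matrix.map_mul (f := Complex.ofRealHom)

theorem map_ofReal_add {l p : Type*} (M M' : Matrix l p ℝ) :
    (M + M').map Complex.ofReal = M.map Complex.ofReal + M'.map Complex.ofReal :=
  Matrix.map_add _ Complex.ofReal_add _ _

theorem conjTranspose_map_ofReal {l p : Type*} (M : Matrix l p ℝ) :
    (M.map Complex.ofReal)ᴴ = Mᵀ.map Complex.ofReal := by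
  ext i j
  simp

theorem posSemidef_map_ofReal {M : Matrix (Fin n) (Fin n) ℝ} (hM : M.PosSemidef) :
    (M.map Complex.ofReal).PosSemidef := by
  rw [← psdSqrt_mul_self hM, map_ofReal_mul]
  nth_rewrite 1 [← transpose_psdSqrt, ← conjTranspose_map_ofReal]
  exact posSemidef_conjTranspose_mul_self _

theorem psdSqrt_map_mulVec_eq_zero {Q : Matrix (Fin n) (Fin n) ℝ} (hQ : Q.PosSemidef)
    {v : Fin n → ℂ} (hv : Q.map Complex.ofReal *ᵥ v = 0) :
    (psdSqrt Q).map Complex.ofReal *ᵥ v = 0 := by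
  rw [← psdSqrt_mul_self hQ, map_ofReal_mul] at hv
  nth_rewrite 1 [← transpose_psdSqrt, ← conjTranspose_map_ofReal] at hv
  exact (conjTranspose_mul_self_mulVec_eq_zero _ _).1 hv

theorem re_map_ofReal_mulVec (M : Matrix (Fin m) (Fin n) ℝ) (v : Fin n → ℂ) (i : Fin m) :
    (M *ᵥ fun j => (v j).re) i = ((M.map Complex.ofReal *ᵥ v) i).re := by
  simp [mulVec, dotProduct]

theorem im_map_ofReal_mulVec (M : Matrix (Fin m) (Fin n) ℝ) (v : Fin n → ℂ) (i : Fin m) :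
    (M *ᵥ fun j => (v j).im) i = ((M.map Complex.ofReal *ᵥ v) i).im := by
  simp [mulVec, dotProduct]

/-- The Popov–Belevitch–Hautus test: no eigenvector is invisible to an observable output. -/
theorem IsObservable.eq_zero_of_eigenvector {A : Matrix (Fin n) (Fin n) ℝ}
    {C : Matrix (Fin m) (Fin n) ℝ} (h : IsObservable A C) {v : Fin n → ℂ} {γ : ℂ}
    (hA : A.map Complex.ofReal *ᵥ v = γ • v) (hC : C.map Complex.ofReal *ᵥ v = 0) : v = 0 := by
  have hpow (i : ℕ) : (A ^ i).map Complex.ofReal *ᵥ v = γ ^ i • v := by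
    induction i with
    | zero => simp
    | succ i ih =>
      rw [pow_succ, map_ofReal_mul, ← mulVec_mulVec, hA, mulVec_smul, ih, smul_smul, pow_succ']
  have hz (i : ℕ) : (C * A ^ i).map Complex.ofReal *ᵥ v = 0 := by
    rw [map_ofReal_mul, ← mulVec_mulVec, hpow, mulVec_smul, hC, smul_zero]
  have hre := h (fun j => (v j).re) fun i _ => funext fun l => by
    rw [re_map_ofReal_mulVec, hz]; rfl
  have him := h (fun j => (v j).im) fun i _ => funext fun l => by
    rw [im_map_ofReal_mulVec, hz]; rfl
  ext j
  exact Complex.ext (congrFun hre j) (congrFun him j)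

theorem star_dotProduct_conjTranspose_mul_mul (M X : Matrix (Fin n) (Fin n) ℂ)
    (v : Fin n → ℂ) : star v ⬝ᵥ (Mᴴ * X * M) *ᵥ v = star (M *ᵥ v) ⬝ᵥ X *ᵥ (M *ᵥ v) := by
  rw [Matrix.mul_assoc, ← mulVec_mulVec, ← mulVec_mulVec, dotProduct_mulVec, star_mulVec]

end Complexification

/-! ### Stability, uniqueness and convergence -/

section Stability

variable {A W Q P : Matrix (Fin n) (Fin n) ℝ}

/-- Test the Lyapunov form of the fixed-point equation on an eigenvector `v` with `|γ| ≥ 1`. It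
forces `Q v = 0` and `W P v = 0`, hence `A v = γ v`, contrary to observability. -/
theorem isStable_closedLoop (hW : W.PosSemidef) (hQ : Q.PosSemidef) (hP : P.PosSemidef)
    (hobs : IsObservable A (psdSqrt Q)) (hfix : riccatiStep A W Q P = P) :
    IsStable (closedLoop A W P) := by
  intro γ hγ
  by_contra! hge
  obtain ⟨v, hv⟩ := hγ.exists_hasEigenvector
  have hMv : (closedLoop A W P).map Complex.ofReal *ᵥ v = γ • v := by
    simpa using hv.apply_eq_smul
  have hlyap := congrArg (fun X : Matrix (Fin n) (Fin n) ℝ => X.map Complex.ofReal)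
    ((riccatiStep_eq_closedLoop hW hP).symm.trans hfix)
  have hclosed := congrArg (fun X : Matrix (Fin n) (Fin n) ℝ => X.map Complex.ofReal)
    (one_add_mul_closedLoop (A := A) hW hP)
  simp only [map_ofReal_add, map_ofReal_mul, ← conjTranspose_map_ofReal] at hlyap hclosed
  have hPc := posSemidef_map_ofReal hP
  have hQc := posSemidef_map_ofReal hQ
  have hWc := posSemidef_map_ofReal hW
  generalize (closedLoop A W P).map Complex.ofReal = M at *
  set p := P.map Complex.ofReal
  set q := Q.map Complex.ofReal
  set w := W.map Complex.ofReal
  have hpM : (p * M) *ᵥ v = γ • (p *ᵥ v) := by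
    rw [← mulVec_mulVec, hMv, mulVec_smul]
  have key := congrArg (fun X => star v ⬝ᵥ X *ᵥ v) hlyap
  simp only [add_mulVec, dotProduct_add,
    star_dotProduct_conjTranspose_mul_mul, hMv, hpM, mulVec_smul, star_smul, smul_dotProduct,
    dotProduct_smul, smul_eq_mul] at key
  have hp := Complex.nonneg_iff.1 (hPc.dotProduct_mulVec_nonneg v)
  have hq := Complex.nonneg_iff.1 (hQc.dotProduct_mulVec_nonneg v)
  have hw := Complex.nonneg_iff.1 (hWc.dotProduct_mulVec_nonneg (p *ᵥ v))
  have hq' := hQc.dotProduct_mulVec_zero_iff v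
  have hw' := hWc.dotProduct_mulVec_zero_iff (p *ᵥ v)
  generalize star v ⬝ᵥ p *ᵥ v = a at *
  generalize star v ⬝ᵥ q *ᵥ v = b at *
  generalize star (p *ᵥ v) ⬝ᵥ w *ᵥ p *ᵥ v = c at *
  have hn : star γ * γ = ((‖γ‖ ^ 2 : ℝ) : ℂ) := by
    rw [Complex.star_def, Complex.conj_mul', Complex.ofReal_pow]
  -- Here `a = v* P v`, `b = v* Q v` and `c = (P v)* W (P v)` are all nonnegative, so `|γ| ≥ 1`
  -- leaves only `b = c = 0`.
  have hkey : b + (((‖γ‖ ^ 2 : ℝ) : ℂ) * a + ((‖γ‖ ^ 2 : ℝ) : ℂ) * c) = a := by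
    rw [← hn]
    linear_combination key
  have hre := congrArg Complex.re hkey
  simp only [Complex.add_re, Complex.re_ofReal_mul] at hre
  have h1 : 1 ≤ ‖γ‖ ^ 2 := one_le_pow₀ hge
  have h2 := mul_le_mul_of_nonneg_right h1 hp.1
  have h3 := mul_le_mul_of_nonneg_right h1 hw.1
  have hb : b = 0 := Complex.ext (by simp only [Complex.zero_re]; linarith) hq.2.symm
  have hc : c = 0 := Complex.ext (by simp only [Complex.zero_re]; linarith) hw.2.symm
  have hAv : A.map Complex.ofReal *ᵥ v = γ • v := by
    rw [← hclosed, add_mulVec, Matrix.mul_assoc, ← mulVec_mulVec, hpM, mulVec_smul, hw'.1 hc, hMv]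
    simp
  exact hv.2 (hobs.eq_zero_of_eigenvector hAv (psdSqrt_map_mulVec_eq_zero hQ (hq'.1 hb)))

theorem riccatiStep_fixedPoint_unique {P' : Matrix (Fin n) (Fin n) ℝ} (hW : W.PosSemidef)
    (hQ : Q.PosSemidef) (hP : P.PosSemidef) (hP' : P'.PosSemidef)
    (hobs : IsObservable A (psdSqrt Q)) (hfix : riccatiStep A W Q P = P)
    (hfix' : riccatiStep A W Q P' = P') : P = P' := by
  have hs := (isStable_closedLoop hW hQ hP hobs hfix).tendsto_pow
  have hs' := (isStable_closedLoop hW hQ hP' hobs hfix').tendsto_pow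
  have e := riccatiStep_sub_riccatiStep (A := A) (Q := Q) hW hP hP'
  rw [hfix, hfix'] at e
  generalize closedLoop A W P = M at *
  generalize closedLoop A W P' = M' at *
  have h (N : ℕ) : (M ^ N)ᵀ * (P - P') * M' ^ N = P - P' := by
    induction N with
    | zero => simp
    | succ N ih =>
      rw [pow_succ, pow_succ, transpose_mul]
      calc _ = Mᵀ * ((M ^ N)ᵀ * (P - P') * M' ^ N) * M' := by simp only [Matrix.mul_assoc]
        _ = P - P' := by rw [ih, ← e]
  exact sub_eq_zero.1 (tendsto_nhds_unique (tendsto_const_nhds.congr fun N => (h N).symm)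
    (tendsto_transpose_mul_mul hs hs' (P - P')))

theorem tendsto_iterate_riccatiStep {C : Matrix (Fin n) (Fin m) ℝ}
    {X : Matrix (Fin n) (Fin n) ℝ} (hQ : Q.PosSemidef) (hP : P.PosSemidef) (hX : X.PosSemidef)
    (hobs : IsObservable A (psdSqrt Q)) (hfix : riccatiStep A (C * Cᵀ) Q P = P)
    (h0 : Tendsto (fun N : ℕ => (riccatiStep A (C * Cᵀ) Q)^[N] 0) atTop (𝓝 P)) :
    Tendsto (fun N : ℕ => (riccatiStep A (C * Cᵀ) Q)^[N] X) atTop (𝓝 P) := by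
  have hW := posSemidef_mul_transpose_self C
  have hK : IsStable (A + C * optGain A C P) := by
    rw [add_mul_optGain hP]
    exact isStable_closedLoop hW hQ hP hobs hfix
  exact tendsto_of_le_of_le
    (fun N => transpose_eq_of_posSemidef (posSemidef_iterate_riccatiStep hW hQ hX N))
    (transpose_eq_of_posSemidef hP) h0
    (tendsto_iterate_costStep hK ((costStep_optGain hP).trans hfix))
    (iterate_riccatiStep_mono hQ PosSemidef.zero hX hX.nonneg)
    (iterate_riccatiStep_le_iterate_costStep hQ hX _)

end Stability

/-! ### The stable subspace of `H'` -/

section StableSubspace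

variable {A W Q P : Matrix (Fin n) (Fin n) ℝ}

theorem isUnit_det_gMatrix (hA : IsUnit A) : IsUnit (gMatrix A W).det := by
  rw [gMatrix, det_fromBlocks_zero₂₁, det_one, one_mul, det_transpose]
  exact (isUnit_iff_isUnit_det _).1 hA

/-- The graph of a Riccati solution is invariant under `H'`, which acts on it as the closed
loop. -/
theorem hMatrix_mul_fromRows (hA : IsUnit A) (hW : W.PosSemidef) (hP : P.PosSemidef)
    (hfix : riccatiStep A W Q P = P) :
    hMatrix A W Q * fromRows (1 : Matrix (Fin n) (Fin n) ℝ) P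
      = fromRows (1 : Matrix (Fin n) (Fin n) ℝ) P * closedLoop A W P := by
  have hG := isUnit_det_gMatrix (W := W) hA
  have h1 := one_add_mul_closedLoop (A := A) hW hP
  have h : fMatrix A Q * fromRows (1 : Matrix (Fin n) (Fin n) ℝ) P
      = gMatrix A W * (fromRows (1 : Matrix (Fin n) (Fin n) ℝ) P * closedLoop A W P) := by
    rw [fMatrix, gMatrix, fromRows_mul, fromBlocks_mul_fromRows, fromBlocks_mul_fromRows]
    congr 1
    · simpa [Matrix.mul_assoc] using h1.symm
    · rw [riccatiStep] at hfix
      simp only [Matrix.mul_one, Matrix.one_mul, Matrix.zero_mul, zero_add, ← Matrix.mul_assoc]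
      nth_rewrite 1 [← hfix]
      abel
  rw [hMatrix, Matrix.mul_assoc, h, nonsing_inv_mul_cancel_left _ _ hG]

/-- The kernel of `[-P, I]` is the graph of `P`, so this describes `H'` modulo the graph. Keeping
the closed loop on the left avoids its inverse. -/
theorem transpose_closedLoop_mul_fromCols_mul_hMatrix (hA : IsUnit A) (hW : W.PosSemidef)
    (hP : P.PosSemidef) (hfix : riccatiStep A W Q P = P) :
    (closedLoop A W P)ᵀ * fromCols (-P) (1 : Matrix (Fin n) (Fin n) ℝ) * hMatrix A W Q
      = fromCols (-P) (1 : Matrix (Fin n) (Fin n) ℝ) := by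
  have hG := isUnit_det_gMatrix (W := W) hA
  have h1 := transpose_closedLoop_mul (A := A) hW hP
  have h : (closedLoop A W P)ᵀ * fromCols (-P) (1 : Matrix (Fin n) (Fin n) ℝ)
      = fromCols (-((closedLoop A W P)ᵀ * P)) (1 : Matrix (Fin n) (Fin n) ℝ) * gMatrix A W := by
    rw [gMatrix, mul_fromCols, fromCols_mul_fromBlocks]
    congr 1
    · simp
    · simp [← h1]
  have h2 : (closedLoop A W P)ᵀ * P * A = P - Q := by
    rw [riccatiStep_eq_transpose_closedLoop_mul hW hP] at hfix
    exact eq_sub_of_add_eq' hfix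
  rw [hMatrix, h, Matrix.mul_assoc, mul_nonsing_inv_cancel_left _ _ hG, fMatrix,
    fromCols_mul_fromBlocks]
  congr 1
  · simp only [Matrix.neg_mul, h2, Matrix.one_mul]
    abel
  · simp

/-- A kernel vector of `1 - γ M` would make `γ⁻¹`, of modulus above `1`, an eigenvalue of `M`. -/
theorem IsStable.isUnit_one_sub_smul_transpose {M : Matrix (Fin n) (Fin n) ℝ} (hM : IsStable M)
    {γ : ℂ} (hγ : ‖γ‖ < 1) : IsUnit (1 - γ • Mᵀ.map Complex.ofReal) := by
  have e : 1 - γ • Mᵀ.map Complex.ofReal = (1 - γ • M.map Complex.ofReal)ᵀ := by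
    simp [transpose_map]
  rw [e, isUnit_transpose, ← Matrix.mulVec_injective_iff_isUnit]
  rw [← coe_mulVecLin, injective_iff_map_eq_zero]
  intro x hx
  by_contra hx0
  have hx' : x = γ • (M.map Complex.ofReal *ᵥ x) := by
    simpa [sub_mulVec, smul_mulVec, sub_eq_zero] using hx
  have hγ0 : γ ≠ 0 := by
    rintro rfl
    exact hx0 (by simpa using hx')
  have hev : Module.End.HasEigenvalue (Matrix.toLin' (M.map Complex.ofReal)) γ⁻¹ := by
    refine Module.End.hasEigenvalue_of_hasEigenvector (x := x)
      ⟨Module.End.mem_eigenspace_iff.2 ?_, hx0⟩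
    rw [toLin'_apply]
    nth_rewrite 2 [hx']
    rw [inv_smul_smul₀ hγ0]
  have := hM _ hev
  rw [norm_inv] at this
  exact absurd this (not_lt.2 ((one_le_inv₀ (norm_pos_iff.2 hγ0)).2 hγ.le))

/-- Stable generalized eigenvectors of `H'` lie on the graph of the Riccati solution. -/
theorem snd_eq_of_mem_maxGenEigenspace (hA : IsUnit A) (hW : W.PosSemidef)
    (hP : P.PosSemidef) (hfix : riccatiStep A W Q P = P) (hs : IsStable (closedLoop A W P))
    {γ : ℂ} (hγ : ‖γ‖ < 1) {v : Fin n ⊕ Fin n → ℂ}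
    (hv : v ∈ Module.End.maxGenEigenspace
      (Matrix.toLin' ((hMatrix A W Q).map Complex.ofReal)) γ) :
    v ∘ Sum.inr = P.map Complex.ofReal *ᵥ (v ∘ Sum.inl) := by
  have hY := congrArg (fun X : Matrix (Fin n) (Fin n ⊕ Fin n) ℝ => X.map Complex.ofReal)
    (transpose_closedLoop_mul_fromCols_mul_hMatrix hA hW hP hfix)
  simp only [map_ofReal_mul] at hY
  have hunit := hs.isUnit_one_sub_smul_transpose hγ
  set M := (closedLoop A W P)ᵀ.map Complex.ofReal
  set H := (hMatrix A W Q).map Complex.ofReal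
  set Y := (fromCols (-P) (1 : Matrix (Fin n) (Fin n) ℝ)).map Complex.ofReal with hYdef
  -- Induction along the Jordan chain: `Y (H - γ) u = 0` gives `(1 - γ M) Y u = 0`, and `1 - γ M` is
  -- invertible.
  have hpow (j : ℕ) : ∀ u, ((Matrix.toLin' H - γ • 1) ^ j) u = 0 → Y *ᵥ u = 0 := by
    induction j with
    | zero =>
      intro u hu
      have : u = 0 := by simpa using hu
      simp [this]
    | succ j ih =>
      intro u hu
      have h0 := ih _ (by rwa [pow_succ] at hu)
      have h1 : (1 - γ • M) *ᵥ (Y *ᵥ u) = M *ᵥ (Y *ᵥ ((Matrix.toLin' H - γ • 1) u)) := by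
        simp only [LinearMap.sub_apply, toLin'_apply, LinearMap.smul_apply, Module.End.one_apply,
          mulVec_sub, mulVec_smul, mulVec_mulVec, hY, sub_mulVec, smul_mulVec,
          Matrix.sub_mul, Matrix.one_mul, Matrix.smul_mul, ← Matrix.mul_assoc]
      rw [h0, mulVec_zero] at h1
      exact (mulVec_injective_iff_isUnit.2 hunit) (h1.trans (mulVec_zero _).symm)
  obtain ⟨j, hj⟩ := (Module.End.mem_maxGenEigenspace _ _ _).1 hv
  have h := hpow j v hj
  have e : Y = fromCols (-P.map Complex.ofReal) 1 := by
    ext i (l | l) <;> simp [hYdef, one_apply, apply_ite]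
  rw [e, fromCols_mulVec, neg_mulVec, one_mulVec] at h
  exact (neg_add_eq_zero.1 h).symm

/-- Every column lies on the graph, so `U₂ = P U₁`; a kernel vector of `U₁` then kills all of `[U₁;
U₂]`. -/
theorem eq_mul_inv_of_isStableEigenbasis (hA : IsUnit A) (hW : W.PosSemidef)
    (hP : P.PosSemidef) (hfix : riccatiStep A W Q P = P) (hs : IsStable (closedLoop A W P))
    {U₁ U₂ : Matrix (Fin n) (Fin n) ℂ} (hU : IsStableEigenbasis (hMatrix A W Q) U₁ U₂) :
    IsUnit U₁ ∧ P.map Complex.ofReal = U₂ * U₁⁻¹ := by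
  obtain ⟨hli, hev⟩ := hU
  have hmul : U₂ = P.map Complex.ofReal * U₁ := by
    ext i j
    obtain ⟨γ, hγ, hj⟩ := hev j
    exact congrFun (snd_eq_of_mem_maxGenEigenspace hA hW hP hfix hs hγ hj) i
  have hunit : IsUnit U₁ := by
    rw [← mulVec_injective_iff_isUnit, ← coe_mulVecLin, injective_iff_map_eq_zero]
    intro x hx
    rw [mulVecLin_apply] at hx
    refine (mulVec_injective_iff.2 hli) ?_
    rw [fromRows_mulVec, hmul, ← mulVec_mulVec, hx]
    ext (i | i) <;> simp
  refine ⟨hunit, ?_⟩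
  rw [hmul, mul_nonsing_inv_cancel_right _ _ ((isUnit_iff_isUnit_det _).1 hunit)]

/-- Over `ℂ` the generalized eigenspaces span, so a basis can be extracted from their union. -/
theorem exists_basis_maxGenEigenspace (f : Module.End ℂ (Fin n → ℂ)) :
    ∃ b : Fin n → Fin n → ℂ, LinearIndependent ℂ b ∧
      ∀ j, ∃ γ, f.HasEigenvalue γ ∧ b j ∈ f.maxGenEigenspace γ := by
  let s : Set (Fin n → ℂ) := ⋃ γ, (f.maxGenEigenspace γ : Set (Fin n → ℂ))
  have hs : ⊤ ≤ Submodule.span ℂ s := by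
    rw [← Module.End.iSup_maxGenEigenspace_eq_top f, Submodule.span_iUnion]
    simp
  let b := Module.Basis.ofSpan hs
  have : Fintype ((linearIndepOn_empty ℂ id).extend (Set.empty_subset s)) :=
    FiniteDimensional.fintypeBasisIndex b
  have hc := Module.finrank_eq_card_basis b
  rw [Module.finrank_fin_fun] at hc
  let e := (Fintype.equivFinOfCardEq hc.symm).symm
  refine ⟨b ∘ e, b.linearIndependent.comp _ e.injective, fun j => ?_⟩
  have hmem : b (e j) ∈ s := Module.Basis.ofSpan_subset hs ⟨_, rfl⟩
  obtain ⟨γ, hγ⟩ := Set.mem_iUnion.1 hmem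
  refine ⟨γ, ?_, hγ⟩
  rw [Module.End.HasEigenvalue,
    ← Module.End.hasUnifEigenvalue_iff_hasUnifEigenvalue_one (k := ⊤) (by simp)]
  exact fun h => b.ne_zero (e j) (by simpa [Module.End.maxGenEigenspace, h] using hγ)

/-- The injection `E = [I; P]` intertwines the closed loop with `H'`, so it carries a basis of
generalized eigenvectors of the former to stable ones of the latter. -/
theorem exists_isStableEigenbasis (hA : IsUnit A) (hW : W.PosSemidef)
    (hP : P.PosSemidef) (hfix : riccatiStep A W Q P = P) (hs : IsStable (closedLoop A W P)) :
    ∃ U₁ U₂ : Matrix (Fin n) (Fin n) ℂ, IsStableEigenbasis (hMatrix A W Q) U₁ U₂ := by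
  obtain ⟨b, hb, hγ⟩ :=
    exists_basis_maxGenEigenspace (Matrix.toLin' ((closedLoop A W P).map Complex.ofReal))
  have hX := congrArg (fun X : Matrix (Fin n ⊕ Fin n) (Fin n) ℝ => X.map Complex.ofReal)
    (hMatrix_mul_fromRows hA hW hP hfix)
  rw [map_ofReal_mul, map_ofReal_mul] at hX
  have hE : (fromRows (1 : Matrix (Fin n) (Fin n) ℝ) P).map Complex.ofReal
      = fromRows 1 (P.map Complex.ofReal) := by
    ext (i | i) j <;> simp [one_apply, apply_ite]
  rw [hE] at hX
  set U : Matrix (Fin n) (Fin n) ℂ := (Matrix.of b)ᵀ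
  set E := fromRows (1 : Matrix (Fin n) (Fin n) ℂ) (P.map Complex.ofReal)
  have hcol (j : Fin n) : (fromRows U (P.map Complex.ofReal * U)).col j = E *ᵥ b j := by
    rw [fromRows_mulVec, one_mulVec]
    ext (i | i) <;> rfl
  refine ⟨U, P.map Complex.ofReal * U, ?_, fun j => ?_⟩
  · have : (fromRows U (P.map Complex.ofReal * U)).col = E.mulVecLin ∘ b := funext hcol
    rw [this]
    refine hb.map' _ (LinearMap.ker_eq_bot.2 fun x y hxy => ?_)
    simp only [mulVecLin_apply, E, fromRows_mulVec, one_mulVec] at hxy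
    exact funext fun i => congrFun hxy (Sum.inl i)
  · obtain ⟨γ, hev, hmem⟩ := hγ j
    refine ⟨γ, hs γ hev, ?_⟩
    rw [hcol]
    obtain ⟨l, hl⟩ := (Module.End.mem_maxGenEigenspace _ _ _).1 hmem
    refine (Module.End.mem_maxGenEigenspace _ _ _).2 ⟨l, ?_⟩
    have hcomm (i : ℕ) (x : Fin n → ℂ) :
        ((Matrix.toLin' ((hMatrix A W Q).map Complex.ofReal) - γ • 1) ^ i) (E *ᵥ x)
          = E *ᵥ (((Matrix.toLin' ((closedLoop A W P).map Complex.ofReal) - γ • 1) ^ i) x) := by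
      induction i generalizing x with
      | zero => simp
      | succ i ih =>
        rw [pow_succ, pow_succ, Module.End.mul_apply, Module.End.mul_apply, ← ih]
        congr 1
        simp only [LinearMap.sub_apply, toLin'_apply, LinearMap.smul_apply, Module.End.one_apply,
          mulVec_sub, mulVec_smul, mulVec_mulVec, hX]
    rw [hcomm, hl, mulVec_zero]

end StableSubspace

end MinimaxLQ

end RiccatiTheory

/-! ### Assembly for the original recursion -/

theorem MinimaxLQ.iterate_riccatiMap_eq {n m k : ℕ} {A Q P : Matrix (Fin n) (Fin n) ℝ}
    {B : Matrix (Fin n) (Fin m) ℝ} {Ξ : Matrix (Fin n) (Fin k) ℝ}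
    {R : Matrix (Fin m) (Fin m) ℝ} {lam : ℝ} (hW : (wMatrix B Ξ R lam).PosSemidef)
    (hQ : Q.PosSemidef) (hP : P.PosSemidef) (N : ℕ) :
    (riccatiMap A B Ξ Q R lam)^[N] P = (riccatiStep A (wMatrix B Ξ R lam) Q)^[N] P := by
  induction N with
  | zero => rfl
  | succ N ih =>
    rw [Function.iterate_succ_apply', Function.iterate_succ_apply', ih,
      riccatiMap_eq_riccatiStep hW (posSemidef_iterate_riccatiStep hW hQ hP N)]

theorem corollary2 {n m k : ℕ}
    (A : Matrix (Fin n) (Fin n) ℝ) (B : Matrix (Fin n) (Fin m) ℝ) (Ξ : Matrix (Fin n) (Fin k) ℝ)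
    (Q : Matrix (Fin n) (Fin n) ℝ) (R : Matrix (Fin m) (Fin m) ℝ) (lam : ℝ)
    (Qf : Matrix (Fin n) (Fin n) ℝ)
    (hQ : Q.PosSemidef) (hR : R.PosDef) (hlam : 0 < lam) (hQf : Qf.PosSemidef)
    (hpen : MinimaxLQ.PenaltyCondition A B Ξ Q R lam Qf)
    (hW : (MinimaxLQ.wMatrix B Ξ R lam).PosSemidef)
    (hstab : MinimaxLQ.IsStabilizable A (MinimaxLQ.psdSqrt (MinimaxLQ.wMatrix B Ξ R lam)))
    (hobs : MinimaxLQ.IsObservable A (MinimaxLQ.psdSqrt Q))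
    (hA : IsUnit A) :
    -- the inverses in the recursion exist
    (∀ T t : ℕ, t < T →
      IsUnit (MinimaxLQ.riccatiDen B Ξ R lam (MinimaxLQ.riccatiP A B Ξ Q R lam Qf T (t + 1)))) ∧
    ∃ Pss : Matrix (Fin n) (Fin n) ℝ,
      -- `Pss` is the unique symmetric positive semidefinite solution of the ARE
      (Pss.PosSemidef ∧ MinimaxLQ.IsARESolution A B Ξ Q R lam Pss ∧
        ∀ P : Matrix (Fin n) (Fin n) ℝ, P.PosSemidef →
          MinimaxLQ.IsARESolution A B Ξ Q R lam P → P = Pss) ∧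
      -- the recursion converges to `Pss` as the horizon tends to infinity
      (∀ t : ℕ, Filter.Tendsto (fun T : ℕ => MinimaxLQ.riccatiP A B Ξ Q R lam Qf T t)
        Filter.atTop (nhds Pss)) ∧
      -- `[U₁; U₂]` can be constructed, and `Pss = U₂ U₁⁻¹` for every choice of it
      (∃ U₁ U₂ : Matrix (Fin n) (Fin n) ℂ, MinimaxLQ.IsStableEigenbasis
        (MinimaxLQ.hMatrix A (MinimaxLQ.wMatrix B Ξ R lam) Q) U₁ U₂) ∧
      ∀ U₁ U₂ : Matrix (Fin n) (Fin n) ℂ, MinimaxLQ.IsStableEigenbasis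
        (MinimaxLQ.hMatrix A (MinimaxLQ.wMatrix B Ξ R lam) Q) U₁ U₂ →
          IsUnit U₁ ∧ Pss.map Complex.ofReal = U₂ * U₁⁻¹ := by
  set W := MinimaxLQ.wMatrix B Ξ R lam with hWdef
  -- The LQ results are applied with input matrix `C = √W`.
  have hWC : MinimaxLQ.psdSqrt W * (MinimaxLQ.psdSqrt W).transpose = W := by
    rw [MinimaxLQ.transpose_psdSqrt, MinimaxLQ.psdSqrt_mul_self hW]
  have hiter {X : Matrix (Fin n) (Fin n) ℝ} (hX : X.PosSemidef) (N : ℕ) :=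
    MinimaxLQ.iterate_riccatiMap_eq (A := A) hW hQ hX N
  have hpsd := MinimaxLQ.posSemidef_iterate_riccatiStep (A := A) hW hQ hQf
  obtain ⟨P, hP, hfix, h0⟩ := MinimaxLQ.exists_tendsto_iterate_riccatiStep_zero hA hQ hstab
  have hlim := MinimaxLQ.tendsto_iterate_riccatiStep hQ hP hQf hobs hfix h0
  rw [hWC] at hfix hlim
  have hs := MinimaxLQ.isStable_closedLoop hW hQ hP hobs hfix
  have hden {X : Matrix (Fin n) (Fin n) ℝ} (hX : X.PosSemidef) :
      IsUnit (MinimaxLQ.riccatiDen B Ξ R lam X) := by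
    rw [MinimaxLQ.riccatiDen_eq]
    exact MinimaxLQ.isUnit_one_add_mul hX hW
  refine ⟨fun T t _ => hden ?_, P, ⟨hP, ⟨hden hP, ?_⟩, fun X hX hare => ?_⟩, fun t => ?_,
    MinimaxLQ.exists_isStableEigenbasis hA hW hP hfix hs,
    fun U₁ U₂ hU => MinimaxLQ.eq_mul_inv_of_isStableEigenbasis hA hW hP hfix hs hU⟩
  · rw [MinimaxLQ.riccatiP, hiter hQf]
    exact hpsd _
  · rw [MinimaxLQ.riccatiMap_eq_riccatiStep hW hP, hfix]
  · refine MinimaxLQ.riccatiStep_fixedPoint_unique hW hQ hX hP hobs ?_ hfix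
    rw [← MinimaxLQ.riccatiMap_eq_riccatiStep hW hX]
    exact hare.2.symm
  · simp only [MinimaxLQ.riccatiP, hiter hQf]
    exact hlim.comp (Filter.tendsto_sub_atTop_nat t)
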